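/- Let $p$ be a prime and let $G=\prod_{i=1}^{k}C_{p^{r_i}}$ be a finite non-cyclic abelian $p$-group, where $k\ge 2$, $r_1\ge r_2\ge\cdots\ge r_k$ and $C_{p^{r_i}}$ is cyclic of order $p^{r_i}$, and let $x_1$ be a generator of the factor $C_{p^{r_1}}$. A stem extension of $G$ is a short exact sequence $1\to N\xrightarrow{\iota}\hat G\xrightarrow{\pi} G\to 1$ with $\iota(N)\subseteq Z(\hat G)\cap \hat G'$; a Schur cover $\tilde G$ of $G$ is a stem extension of maximal order. The deep commuting graph $\Delta_D(G)$ is the simple graph with vertex set $G$ in which two distinct elements are adjacent if and only if their preimages in a Schur cover $\tilde G$ of $G$ commute. A vertex is dominant if it is adjacent to all other vertices. Then, whichever Schur cover of $G$ is used, the set of dominant vertices of $\Delta_D(G)$ is the cyclic subgroup $\langle x_1^{p^{r_2}}\rangle$. In particular, this set is $\{e\}$ if and only if $r_1=r_2$. -/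

import Mathlib

universe u v

namespace GroupExtension

/-- A stem extension `1 → N → E → G → 1`: the image of `N` lies in `Z(E) ∩ E'`.
In particular the extension is central. -/
def IsStem {G : Type u} {N E : Type v} [Group G] [Group N] [Group E]
    (S : GroupExtension N E G) : Prop :=
  S.inl.range ≤ Subgroup.center E ⊓ commutator E

/-- A Schur cover of `G`: a (finite) stem extension of `G` of maximal order among all stem
extensions of `G`. By `IsStem.finite` below, every stem extension of a finite group is finite, so
`Nat.card` is the genuine order. -/
structure IsSchurCover {G : Type u} {N E : Type v} [Group G] [Group N] [Group E]
    (S : GroupExtension N E G) : Prop where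
  isStem : S.IsStem
  finite : Finite E
  card_le : ∀ (N' E' : Type v) [Group N'] [Group E'] (S' : GroupExtension N' E' G),
    S'.IsStem → Nat.card E' ≤ Nat.card E

/-- The deep commuting graph of `G`, formed with the extension `S` (a Schur cover of `G`): the
vertices are the elements of `G`, and two distinct elements are adjacent if their preimages
in `E` commute. For a central extension it does not matter which preimages are taken. -/
def deepCommutingGraph {G : Type u} {N E : Type v} [Group G] [Group N] [Group E]
    (S : GroupExtension N E G) : SimpleGraph G where
  Adj g h := g ≠ h ∧ ∀ a b : E, S.rightHom a = g → S.rightHom b = h → Commute a b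
  symm := ⟨fun _ _ H => ⟨H.1.symm, fun a b ha hb => (H.2 b a hb ha).symm⟩⟩
  loopless := ⟨fun _ H => H.1 rfl⟩

section Existence

open scoped commutatorElement

variable {G : Type u} {N E : Type v} [Group G] [Group N] [Group E]

theorem IsStem.commutatorSet_subset {S : GroupExtension N E G} (hS : S.IsStem) :
    commutatorSet E ⊆ Set.range (fun q : G × G =>
      ⁅Function.surjInv S.rightHom_surjective q.1, Function.surjInv S.rightHom_surjective q.2⁆) := by
  rintro _ ⟨a, b, rfl⟩
  refine ⟨(S.rightHom a, S.rightHom b), ?_⟩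
  have key : ∀ c : E, ∃ z ∈ Subgroup.center E,
      c = z * Function.surjInv S.rightHom_surjective (S.rightHom c) := by
    intro c
    refine ⟨c * (Function.surjInv S.rightHom_surjective (S.rightHom c))⁻¹, ?_, by simp⟩
    refine (hS ?_).1
    rw [S.range_inl_eq_ker_rightHom, MonoidHom.mem_ker, map_mul, map_inv,
      Function.surjInv_eq S.rightHom_surjective, mul_inv_cancel]
  obtain ⟨z, hz, ha⟩ := key a
  obtain ⟨w, hw, hb⟩ := key b
  dsimp only
  generalize Function.surjInv S.rightHom_surjective (S.rightHom a) = a' at ha ⊢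
  generalize Function.surjInv S.rightHom_surjective (S.rightHom b) = b' at hb ⊢
  subst ha hb
  rw [Subgroup.mem_center_iff] at hz hw
  have hwi : ∀ g, g * w⁻¹ = w⁻¹ * g := fun g =>
    ((show Commute g w from hw g).inv_right : Commute g w⁻¹)
  rw [commutatorElement_def, commutatorElement_def, mul_inv_rev, mul_inv_rev]
  calc a' * b' * a'⁻¹ * b'⁻¹
      = z * (a' * b' * a'⁻¹ * b'⁻¹) * z⁻¹ := by rw [← hz]; group
    _ = z * a' * b' * a'⁻¹ * (b'⁻¹ * z⁻¹) := by group
    _ = z * a' * b' * a'⁻¹ * (z⁻¹ * b'⁻¹) := by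
        rw [show b'⁻¹ * z⁻¹ = z⁻¹ * b'⁻¹ from
          ((show Commute b'⁻¹ z from hz _).inv_right : Commute b'⁻¹ z⁻¹)]
    _ = w * (z * a' * b' * (a'⁻¹ * z⁻¹) * b'⁻¹) * w⁻¹ := by rw [← hw]; group
    _ = (w * (z * a')) * b' * (a'⁻¹ * z⁻¹) * (b'⁻¹ * w⁻¹) := by group
    _ = z * a' * (w * b') * (a'⁻¹ * z⁻¹) * (b'⁻¹ * w⁻¹) := by rw [← hw]; group

variable [Finite G]

/-- The order of a stem extension of a finite group is bounded in terms of the group. -/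
theorem IsStem.finite_and_card_le {S : GroupExtension N E G} (hS : S.IsStem) :
    Finite E ∧ Nat.card E ≤ (∑ i ∈ Finset.range (Nat.card (G × G) + 1),
      Subgroup.cardCommutatorBound i) * Nat.card G := by
  have hfin : Finite (commutatorSet E) := (Set.finite_range _).subset hS.commutatorSet_subset
  have hle : Nat.card (commutatorSet E) ≤ Nat.card (G × G) :=
    (Nat.card_mono (Set.finite_range _) hS.commutatorSet_subset).trans
      (Finite.card_range_le _)
  have hker : S.rightHom.ker ≤ commutator E := by
    rw [← S.range_inl_eq_ker_rightHom]
    exact hS.trans inf_le_right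
  have hkfin : Finite S.rightHom.ker := Finite.of_injective _ (Subgroup.inclusion_injective hker)
  have hcard : Nat.card E = Nat.card S.rightHom.ker * Nat.card G := by
    rw [← S.rightHom.ker.card_mul_index, Subgroup.index_ker,
      MonoidHom.range_eq_top.2 S.rightHom_surjective, Subgroup.card_top]
  refine ⟨(Nat.card_pos_iff.1 (hcard ▸ Nat.mul_pos Nat.card_pos Nat.card_pos)).2, ?_⟩
  rw [hcard]
  refine Nat.mul_le_mul_right _ ?_
  calc Nat.card S.rightHom.ker ≤ Nat.card (commutator E) :=
        Nat.card_le_card_of_injective _ (Subgroup.inclusion_injective hker)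
    _ ≤ Subgroup.cardCommutatorBound (Nat.card (commutatorSet E)) :=
        Subgroup.card_commutator_le_of_finite_commutatorSet E
    _ ≤ _ := Finset.single_le_sum (f := Subgroup.cardCommutatorBound) (fun _ _ => Nat.zero_le _)
        (Finset.mem_range.2 (Nat.lt_succ_of_le hle))

theorem IsStem.finite {S : GroupExtension N E G} (hS : S.IsStem) : Finite E :=
  hS.finite_and_card_le.1

end Existence

/-- Every finite group has a Schur cover. -/
theorem exists_isSchurCover (G : Type u) [Group G] [Finite G] :
    ∃ (N E : Type v) (_ : Group N) (_ : Group E) (S : GroupExtension N E G),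
      S.IsSchurCover := by
  let P : Set ℕ := {m | ∃ (N E : Type v) (_ : Group N) (_ : Group E) (S : GroupExtension N E G),
    S.IsStem ∧ Nat.card E = m}
  have hne : P.Nonempty := by
    let S : GroupExtension PUnit.{v + 1} (Shrink.{v} G) G :=
      { inl := 1
        rightHom := (Shrink.mulEquiv.{v} (α := G)).toMonoidHom
        inl_injective := fun _ _ _ => rfl
        range_inl_eq_ker_rightHom := by
          rw [(MonoidHom.ker_eq_bot_iff _).2 (Shrink.mulEquiv.{v} (α := G)).injective]
          ext x
          simp
        rightHom_surjective := (Shrink.mulEquiv.{v} (α := G)).surjective }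
    refine ⟨_, PUnit.{v + 1}, Shrink.{v} G, inferInstance, inferInstance, S, ?_, rfl⟩
    rintro _ ⟨x, rfl⟩
    exact Subgroup.one_mem _
  have hbdd : BddAbove P := by
    refine ⟨(∑ i ∈ Finset.range (Nat.card (G × G) + 1),
      Subgroup.cardCommutatorBound i) * Nat.card G, ?_⟩
    rintro _ ⟨N, E, _, _, S, hS, rfl⟩
    exact hS.finite_and_card_le.2
  obtain ⟨N, E, _, _, S, hS, hm⟩ := Nat.sSup_mem hne hbdd
  refine ⟨N, E, _, _, S, hS, hS.finite, fun N' E' _ _ S' hS' => ?_⟩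
  rw [hm]
  exact le_csSup hbdd ⟨N', E', _, _, S', hS', rfl⟩

end GroupExtension

/-!
The dominant vertices of the deep commuting graph of a stem extension `π : E → G` form the image of
the center of `E`. When `G` is abelian, commutators in `E` define an alternating bilinear pairing on
`G` whose radical is that image. Write `G` additively as `A = ∏ i, ZMod (d i)` with `d j ∣ d i` for
`i < j`; then the pairing factors as `φ ∘ ∧` through the exterior square of `A`, which is the
product of the `ZMod (d j)` over the pairs `i < j`. Since `ker π` lies in `[E, E]`, which is
generated by the values of the pairing, its order is at most that of the image of `φ`. On the other
hand, the bilinear cocycle `(a, b) ↦ (a i * b j)_{i < j}` defines a stem extension of `G` whose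
kernel is the exterior square. If `E` is a Schur cover, maximality of its order therefore makes `φ`
injective, and the pairing has the same radical as `∧`. An element `a` is in the radical of `∧` iff
`a i = 0 = a j` in `ZMod (d j)` for all `i < j`, which leaves the multiples of `d 1` in the largest
factor.
-/

theorem addMonoidHom_zmod_ext {n : ℕ} {M : Type*} [AddGroup M] {f g : ZMod n →+ M}
    (h : f 1 = g 1) : f = g := by
  ext x
  obtain ⟨k, rfl⟩ := ZMod.intCast_surjective x
  rw [← zsmul_one k, map_zsmul, map_zsmul, h]

theorem addMonoidHom_pi_zmod_ext₂ {ι : Type*} [Finite ι] [DecidableEq ι] {d : ι → ℕ}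
    {M : Type*} [AddCommGroup M] {f g : (∀ i, ZMod (d i)) →+ (∀ i, ZMod (d i)) →+ M}
    (h : ∀ i j, f (Pi.single i 1) (Pi.single j 1) = g (Pi.single i 1) (Pi.single j 1)) :
    f = g :=
  AddMonoidHom.functions_ext' _ _ _ fun i => addMonoidHom_zmod_ext <|
    AddMonoidHom.functions_ext' _ _ _ fun j => addMonoidHom_zmod_ext (h i j)

theorem eq_neg_swap_of_apply_self_eq_zero {A M : Type*} [AddCommGroup A] [AddCommGroup M]
    {β : A →+ A →+ M} (hβ : ∀ x, β x x = 0) (x y : A) : β x y = -β y x := by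
  have h := hβ (x + y)
  simp only [map_add, AddMonoidHom.add_apply, hβ, zero_add, add_zero] at h
  rw [add_comm] at h
  exact eq_neg_of_add_eq_zero_left h

/-- The exterior square of `∏ i, ZMod (d i)`, where `d j ∣ d i` whenever `i < j`: the factor at
`i < j` is the exterior product of the two cyclic factors, of order `d j`. It is the Schur
multiplier of `∏ i, ZMod (d i)`. -/
abbrev ExteriorSquare {ι : Type*} [LinearOrder ι] (d : ι → ℕ) : Type _ :=
  ∀ q : {q : ι × ι // q.1 < q.2}, ZMod (d q.1.2)

namespace ExteriorSquare

section LinearOrder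

variable {ι : Type*} [LinearOrder ι] {d : ι → ℕ} (hd : ∀ ⦃i j⦄, i < j → d j ∣ d i)

/-- The bilinear map whose coordinate at `i < j` is `a i * b j`, used as a cocycle: it is not
alternating, but its antisymmetrization is `wedge`. -/
def cocycle : (∀ i, ZMod (d i)) →+ (∀ i, ZMod (d i)) →+ ExteriorSquare d :=
  AddMonoidHom.mk' (fun a => AddMonoidHom.mk'
      (fun b q => ZMod.castHom (hd q.2) (ZMod (d q.1.2)) (a q.1.1) * b q.1.2)
      (fun _ _ => funext fun _ => mul_add _ _ _))
    (fun _ _ => AddMonoidHom.ext fun _ => funext fun _ =>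
      (congrArg (· * _) (map_add _ _ _)).trans (add_mul _ _ _))

/-- The universal alternating bilinear map on `∏ i, ZMod (d i)`, with coordinate
`a i * b j - b i * a j` at `i < j`. -/
def wedge : (∀ i, ZMod (d i)) →+ (∀ i, ZMod (d i)) →+ ExteriorSquare d :=
  cocycle hd - (cocycle hd).flip

theorem wedge_apply (a b : ∀ i, ZMod (d i)) (q : {q : ι × ι // q.1 < q.2}) :
    wedge hd a b q = ZMod.castHom (hd q.2) (ZMod (d q.1.2)) (a q.1.1) * b q.1.2 -
      ZMod.castHom (hd q.2) (ZMod (d q.1.2)) (b q.1.1) * a q.1.2 :=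
  rfl

theorem wedge_self (a : ∀ i, ZMod (d i)) : wedge hd a a = 0 :=
  sub_self _

theorem wedge_single_single {i j : ι} (hij : i < j) (c : ZMod (d j)) :
    wedge hd (Pi.single i 1) (Pi.single j c) =
      Pi.single (M := fun q : {q : ι × ι // q.1 < q.2} => ZMod (d q.1.2)) ⟨(i, j), hij⟩ c := by
  ext ⟨⟨k, l⟩, hkl⟩
  rw [wedge_apply]
  dsimp only at hkl ⊢
  have hswap : ZMod.castHom (hd hkl) (ZMod (d l)) ((Pi.single j c : ∀ i, ZMod (d i)) k) *
      (Pi.single i 1 : ∀ i, ZMod (d i)) l = 0 := by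
    rcases ne_or_eq k j with hk | rfl
    · rw [Pi.single_eq_of_ne hk, map_zero, zero_mul]
    · rw [Pi.single_eq_of_ne (hij.trans hkl).ne', mul_zero]
  rw [hswap, sub_zero]
  rcases ne_or_eq k i with hk | rfl
  · rw [Pi.single_eq_of_ne hk, map_zero, zero_mul, Pi.single_eq_of_ne (by simp [hk])]
  rcases ne_or_eq l j with hl | rfl
  · rw [Pi.single_eq_of_ne hl, mul_zero, Pi.single_eq_of_ne (by simp [hl])]
  · simp only [Pi.single_eq_same, map_one, one_mul]

theorem closure_range_wedge [Finite ι] :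
    AddSubgroup.closure (Set.range fun x : (∀ i, ZMod (d i)) × (∀ i, ZMod (d i)) =>
      wedge hd x.1 x.2) = ⊤ :=
  (AddSubgroup.eq_top_iff' _).2 fun m => AddSubgroup.pi_mem_of_single_mem m fun q =>
    AddSubgroup.subset_closure
      ⟨(Pi.single q.1.1 1, Pi.single q.1.2 (m q)), wedge_single_single hd q.2 (m q)⟩

theorem exists_apply_wedge_eq [Finite ι] {M : Type*} [AddCommGroup M]
    {β : (∀ i, ZMod (d i)) →+ (∀ i, ZMod (d i)) →+ M} (hβ : ∀ a, β a a = 0) :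
    ∃ φ : ExteriorSquare d →+ M, ∀ a b, φ (wedge hd a b) = β a b := by
  have := Fintype.ofFinite ι
  let φ : ExteriorSquare d →+ M := ∑ q : {q : ι × ι // q.1 < q.2},
    ((β (Pi.single q.1.1 1)).comp (AddMonoidHom.single _ q.1.2)).comp (Pi.evalAddMonoidHom _ q)
  have φ_wedge_of_lt {i j : ι} (hij : i < j) :
      φ (wedge hd (Pi.single i 1) (Pi.single j 1)) = β (Pi.single i 1) (Pi.single j 1) := by
    rw [wedge_single_single hd hij, AddMonoidHom.finsetSum_apply,
      Fintype.sum_eq_single ⟨(i, j), hij⟩ fun q hq => ?_]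
    · simp
    · simp [Pi.single_eq_of_ne hq]
  suffices h : (wedge hd).compr₂ φ = β from
    ⟨φ, fun a => DFunLike.congr_fun (DFunLike.congr_fun h a)⟩
  refine addMonoidHom_pi_zmod_ext₂ fun i j => ?_
  rw [AddMonoidHom.compr₂_apply]
  rcases lt_trichotomy i j with hij | rfl | hji
  · exact φ_wedge_of_lt hij
  · rw [wedge_self, map_zero, hβ]
  · rw [eq_neg_swap_of_apply_self_eq_zero (wedge_self hd), map_neg, φ_wedge_of_lt hji,
      ← eq_neg_swap_of_apply_self_eq_zero hβ]

theorem wedge_eq_zero_iff {a : ∀ i, ZMod (d i)} : wedge hd a = 0 ↔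
    ∀ ⦃i j⦄ (hij : i < j), ZMod.castHom (hd hij) (ZMod (d j)) (a i) = 0 ∧ a j = 0 := by
  constructor
  · intro ha i j hij
    have coord_eq_zero (b) : wedge hd a b ⟨(i, j), hij⟩ = 0 := by rw [ha]; rfl
    constructor
    · simpa [wedge_apply, hij.ne] using coord_eq_zero (Pi.single j 1)
    · simpa [wedge_apply, hij.ne', -ZMod.castHom_apply] using coord_eq_zero (Pi.single i 1)
  · intro ha
    ext b q
    rw [wedge_apply, (ha q.2).1, (ha q.2).2, zero_mul, mul_zero, sub_zero]
    rfl

end LinearOrder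

section Fin

variable {n : ℕ} {d : Fin (n + 2) → ℕ} (hd : ∀ ⦃i j⦄, i < j → d j ∣ d i)

theorem wedge_nsmul_single_zero : wedge hd (d 1 • Pi.single 0 1) = 0 := by
  refine (wedge_eq_zero_iff hd).2 fun i j hij => ⟨?_, ?_⟩
  · have hdvd : d j ∣ d 1 := by
      rcases eq_or_ne j 1 with rfl | hj
      · exact dvd_rfl
      · exact hd ((Fin.one_le_of_ne_zero (Fin.ne_zero_of_lt hij)).lt_of_ne hj.symm)
    rw [Pi.smul_apply, map_nsmul, nsmul_eq_mul, (ZMod.natCast_eq_zero_iff _ _).2 hdvd, zero_mul]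
  · rw [Pi.smul_apply, Pi.single_eq_of_ne (Fin.ne_zero_of_lt hij), smul_zero]

theorem wedge_eq_zero_iff_mem_zmultiples {a : ∀ i, ZMod (d i)} :
    wedge hd a = 0 ↔ a ∈ AddSubgroup.zmultiples (d 1 • Pi.single 0 1 : ∀ i, ZMod (d i)) := by
  constructor
  · intro ha
    have coords := (wedge_eq_zero_iff hd).1 ha
    have a_eq_single : a = Pi.single 0 (a 0) := by
      ext j
      rcases eq_or_ne j 0 with rfl | hj
      · rw [Pi.single_eq_same]
      · rw [(coords (Fin.pos_iff_ne_zero.2 hj)).2, Pi.single_eq_of_ne hj]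
    obtain ⟨k, hk⟩ := ZMod.intCast_surjective (a 0)
    obtain ⟨t, rfl⟩ : (d 1 : ℤ) ∣ k := by
      have h := (coords Fin.zero_lt_one).1
      rwa [← hk, map_intCast, ZMod.intCast_zmod_eq_zero_iff_dvd] at h
    refine AddSubgroup.mem_zmultiples_iff.2 ⟨t, ?_⟩
    rw [a_eq_single, ← hk, ← Pi.single_smul, ← Pi.single_smul, nsmul_one, zsmul_eq_mul,
      Int.cast_mul, Int.cast_natCast, mul_comm]
  · rintro ⟨t, rfl⟩
    rw [map_zsmul, wedge_nsmul_single_zero, smul_zero]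

end Fin

end ExteriorSquare

section CommutatorPairing

open scoped commutatorElement IsMulCommutative

variable {E : Type*} [Group E]

theorem commutatorElement_mul_left_of_mem_center {a b c : E} (h : ⁅b, c⁆ ∈ Subgroup.center E) :
    ⁅a * b, c⁆ = ⁅a, c⁆ * ⁅b, c⁆ := by
  rw [commutatorElement_mul_left_eq_conj_mul, Subgroup.mem_center_iff.1 h a, mul_inv_cancel_right,
    Subgroup.mem_center_iff.1 h]

theorem commutatorElement_mul_right_of_mem_center {a b c : E} (h : ⁅a, c⁆ ∈ Subgroup.center E) :
    ⁅a, b * c⁆ = ⁅a, b⁆ * ⁅a, c⁆ := by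
  rw [commutatorElement_mul_right_eq_mul_conj, mul_assoc _ b, Subgroup.mem_center_iff.1 h b,
    ← mul_assoc, mul_inv_cancel_right]

theorem mem_center_iff_commutatorElement_eq_one {a : E} :
    a ∈ Subgroup.center E ↔ ∀ b : E, ⁅a, b⁆ = 1 := by
  simp only [Subgroup.mem_center_iff, commutatorElement_eq_one_iff_mul_comm, eq_comm]

theorem commutatorElement_mul_mul_of_mem_center {z w : E} (hz : z ∈ Subgroup.center E)
    (hw : w ∈ Subgroup.center E) (a b : E) : ⁅a * z, b * w⁆ = ⁅a, b⁆ := by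
  have hz_comm (c : E) : ⁅z, c⁆ = 1 := mem_center_iff_commutatorElement_eq_one.1 hz c
  have hw_comm (c : E) : ⁅c, w⁆ = 1 := by
    rw [← commutatorElement_inv, mem_center_iff_commutatorElement_eq_one.1 hw, inv_one]
  rw [commutatorElement_mul_left_of_mem_center (hz_comm _ ▸ one_mem _), hz_comm, mul_one,
    commutatorElement_mul_right_of_mem_center (hw_comm _ ▸ one_mem _), hw_comm, mul_one]

theorem exists_mem_center_eq_mul {Q : Type*} [Group Q] {π : E →* Q}
    (hc : π.ker ≤ Subgroup.center E) {a b : E} (h : π a = π b) :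
    ∃ z ∈ Subgroup.center E, a = b * z :=
  ⟨b⁻¹ * a, hc (by rw [MonoidHom.mem_ker, map_mul, map_inv, h, inv_mul_cancel]),
    (mul_inv_cancel_left b a).symm⟩

theorem commutatorElement_congr {Q : Type*} [Group Q] {π : E →* Q}
    (hc : π.ker ≤ Subgroup.center E) {a a' b b' : E} (ha : π a = π a') (hb : π b = π b') :
    ⁅a, b⁆ = ⁅a', b'⁆ := by
  obtain ⟨z, hz, rfl⟩ := exists_mem_center_eq_mul hc ha
  obtain ⟨w, hw, rfl⟩ := exists_mem_center_eq_mul hc hb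
  exact commutatorElement_mul_mul_of_mem_center hz hw a' b'

theorem commutatorElement_mem_of_ker_le {Q : Type*} [CommGroup Q] {π : E →* Q} {H : Subgroup E}
    (hH : π.ker ≤ H) (a b : E) : ⁅a, b⁆ ∈ H :=
  hH (by rw [MonoidHom.mem_ker, map_commutatorElement, commutatorElement_eq_one_iff_mul_comm,
    mul_comm])

variable {A : Type*} [AddCommGroup A] {π : E →* Multiplicative A} (hπ : Function.Surjective π)
  (hc : π.ker ≤ Subgroup.center E)

/-- The commutator pairing of a central extension `π : E →* Multiplicative A` of an abelian group:
it sends `π a, π b` to the commutator `⁅a, b⁆`, which does not depend on the choice of the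
preimages. -/
noncomputable def commutatorPairing : A →+ A →+ Additive (Subgroup.center E) :=
  let s : A → E := fun x => Function.surjInv hπ (.ofAdd x)
  have π_s (x : A) : π (s x) = .ofAdd x := Function.surjInv_eq hπ _
  have π_s_add (x y : A) : π (s (x + y)) = π (s x * s y) := by
    rw [map_mul, π_s, π_s, π_s, ofAdd_add]
  have mem_center := commutatorElement_mem_of_ker_le hc
  AddMonoidHom.mk' (fun x => AddMonoidHom.mk' (fun y => .ofMul ⟨⁅s x, s y⁆, mem_center _ _⟩)
    fun y y' => congrArg Additive.ofMul <| Subtype.ext <|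
      (commutatorElement_congr hc rfl (π_s_add y y')).trans
        (commutatorElement_mul_right_of_mem_center (mem_center _ _)))
    fun x x' => AddMonoidHom.ext fun y => congrArg Additive.ofMul <| Subtype.ext <|
      (commutatorElement_congr hc (π_s_add x x') rfl).trans
        (commutatorElement_mul_left_of_mem_center (mem_center _ _))

theorem commutatorPairing_apply_apply (a b : E) :
    commutatorPairing hπ hc (π a).toAdd (π b).toAdd =
      .ofMul ⟨⁅a, b⁆, commutatorElement_mem_of_ker_le hc a b⟩ :=
  congrArg Additive.ofMul <| Subtype.ext <|
    commutatorElement_congr hc (Function.surjInv_eq hπ _) (Function.surjInv_eq hπ _)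

theorem commutatorPairing_apply_apply_eq_zero_iff {a b : E} :
    commutatorPairing hπ hc (π a).toAdd (π b).toAdd = 0 ↔ ⁅a, b⁆ = 1 := by
  rw [commutatorPairing_apply_apply, ofMul_eq_zero, Subgroup.mk_eq_one]

theorem commutatorPairing_self (x : A) : commutatorPairing hπ hc x x = 0 := by
  obtain ⟨a, rfl⟩ := hπ x
  exact (commutatorPairing_apply_apply_eq_zero_iff hπ hc).2 (commutatorElement_self a)

theorem commutatorPairing_eq_zero_iff {a : E} :
    commutatorPairing hπ hc (π a).toAdd = 0 ↔ a ∈ Subgroup.center E := by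
  simp only [mem_center_iff_commutatorElement_eq_one,
    ← commutatorPairing_apply_apply_eq_zero_iff hπ hc, DFunLike.ext_iff]
  exact hπ.forall

variable {B : Type*} [AddGroup B] {φ : B →+ Additive (Subgroup.center E)}

theorem commutator_le_range_of_commutatorPairing_mem_range
    (hφ : ∀ x y, commutatorPairing hπ hc x y ∈ φ.range) :
    commutator E ≤ ((Subgroup.center E).subtype.comp φ.toMultiplicativeLeft).range := by
  rw [commutator_def, Subgroup.commutator_le]
  intro a _ b _
  obtain ⟨m, hm⟩ := hφ (π a).toAdd (π b).toAdd
  rw [commutatorPairing_apply_apply] at hm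
  exact ⟨.ofAdd m, congrArg (fun z => (z.toMul : E)) hm⟩

theorem injective_of_commutatorPairing_mem_range [Finite B] (hker : π.ker ≤ commutator E)
    (hcard : Nat.card B ≤ Nat.card π.ker) (hφ : ∀ x y, commutatorPairing hπ hc x y ∈ φ.range) :
    Function.Injective φ := by
  let ψ : Multiplicative B →* E := (Subgroup.center E).subtype.comp φ.toMultiplicativeLeft
  have ker_le_range : π.ker ≤ ψ.range :=
    hker.trans (commutator_le_range_of_commutatorPairing_mem_range hπ hc hφ)
  have card_le_card_range : Nat.card (Multiplicative B) ≤ Nat.card ψ.range :=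
    hcard.trans (Nat.card_mono (Set.finite_range ψ) ker_le_range)
  have ψ_injective : Function.Injective ψ := ψ.rangeRestrict_injective_iff.1
    (ψ.rangeRestrict_surjective.bijective_of_nat_card_le card_le_card_range).1
  exact fun _ _ h => ψ_injective (congrArg (fun z => (z.toMul : E)) h)

end CommutatorPairing

/-- The central extension of `A` by `M` with bilinear cocycle `f`: the set `A × M` with
multiplication `(a, m) * (b, n) = (a + b, m + n + f a b)`. -/
@[ext]
structure BilinearExtension {A M : Type*} [AddCommGroup A] [AddCommGroup M]
    (f : A →+ A →+ M) where
  fst : A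
  snd : M

namespace BilinearExtension

open scoped commutatorElement

variable {A M : Type*} [AddCommGroup A] [AddCommGroup M] {f : A →+ A →+ M}

instance : Mul (BilinearExtension f) :=
  ⟨fun x y => ⟨x.fst + y.fst, x.snd + y.snd + f x.fst y.fst⟩⟩

instance : One (BilinearExtension f) := ⟨⟨0, 0⟩⟩

instance : Inv (BilinearExtension f) := ⟨fun x => ⟨-x.fst, -x.snd + f x.fst x.fst⟩⟩

@[simp] theorem mul_fst (x y : BilinearExtension f) : (x * y).fst = x.fst + y.fst := rfl

@[simp] theorem mul_snd (x y : BilinearExtension f) :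
    (x * y).snd = x.snd + y.snd + f x.fst y.fst := rfl

@[simp] theorem one_fst : (1 : BilinearExtension f).fst = 0 := rfl

@[simp] theorem one_snd : (1 : BilinearExtension f).snd = 0 := rfl

@[simp] theorem inv_fst (x : BilinearExtension f) : x⁻¹.fst = -x.fst := rfl

@[simp] theorem inv_snd (x : BilinearExtension f) : x⁻¹.snd = -x.snd + f x.fst x.fst := rfl

instance : Group (BilinearExtension f) :=
  Group.ofLeftAxioms
    (fun x y z => by
      ext
      · simp only [mul_fst, add_assoc]
      · simp only [mul_snd, mul_fst, map_add, AddMonoidHom.add_apply]; abel)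
    (fun x => by ext <;> simp)
    (fun x => by ext <;> simp)

theorem card_eq : Nat.card (BilinearExtension f) = Nat.card A * Nat.card M := by
  rw [← Nat.card_prod]
  exact Nat.card_congr ⟨fun x => (x.fst, x.snd), fun x => ⟨x.1, x.2⟩, fun _ => rfl, fun _ => rfl⟩

variable (f) in
/-- The inclusion of the kernel of `BilinearExtension.proj f`. -/
def inl : Multiplicative M →* BilinearExtension f :=
  MonoidHom.mk' (fun m => ⟨0, m.toAdd⟩) fun _ _ => by ext <;> simp

variable (f) in
/-- The projection of the extension of `A` by `M` onto `A`. -/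
def proj : BilinearExtension f →* Multiplicative A :=
  MonoidHom.mk' (fun x => .ofAdd x.fst) fun _ _ => rfl

theorem proj_surjective : Function.Surjective (proj f) :=
  fun a => ⟨⟨a.toAdd, 0⟩, rfl⟩

theorem ker_proj_eq_range_inl : (proj f).ker = (inl f).range := by
  ext x
  constructor
  · exact fun hx => ⟨.ofAdd x.snd, BilinearExtension.ext (Eq.symm hx) rfl⟩
  · rintro ⟨m, rfl⟩
    rfl

theorem inl_mem_center (m : Multiplicative M) :
    inl f m ∈ Subgroup.center (BilinearExtension f) := by
  refine Subgroup.mem_center_iff.2 fun x => ?_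
  ext <;> simp [inl, add_comm]

theorem commutatorElement_eq_inl (x y : BilinearExtension f) :
    ⁅x, y⁆ = inl f (.ofAdd (f x.fst y.fst - f y.fst x.fst)) := by
  rw [commutatorElement_def, mul_inv_eq_iff_eq_mul, mul_inv_eq_iff_eq_mul]
  ext
  · simp [inl, add_comm]
  · simp only [inl, MonoidHom.mk'_apply, toAdd_ofAdd, mul_snd, mul_fst, map_zero,
      AddMonoidHom.zero_apply, zero_add, add_zero]
    abel

theorem ker_proj_le_center_inf_commutator
    (hf : AddSubgroup.closure (Set.range fun x : A × A => f x.1 x.2 - f x.2 x.1) = ⊤) :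
    (proj f).ker ≤ Subgroup.center (BilinearExtension f) ⊓ commutator (BilinearExtension f) := by
  have top_le : ⊤ ≤ Subgroup.toAddSubgroup' ((commutator (BilinearExtension f)).comap (inl f)) := by
    rw [← hf, AddSubgroup.closure_le]
    rintro _ ⟨⟨a, b⟩, rfl⟩
    change inl f (.ofAdd (f a b - f b a)) ∈ commutator (BilinearExtension f)
    rw [← commutatorElement_eq_inl ⟨a, 0⟩ ⟨b, 0⟩]
    exact Subgroup.commutator_mem_commutator (Subgroup.mem_top _) (Subgroup.mem_top _)
  rw [ker_proj_eq_range_inl]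
  rintro _ ⟨m, rfl⟩
  exact ⟨inl_mem_center m, top_le (AddSubgroup.mem_top m.toAdd)⟩

end BilinearExtension

section StemExtension

variable {G : Type u} {N E : Type v} [Group G] [Group N] [Group E] {S : GroupExtension N E G}

theorem ker_rightHom_le_center (hS : S.IsStem) : S.rightHom.ker ≤ Subgroup.center E :=
  S.range_inl_eq_ker_rightHom ▸ hS.trans inf_le_left

theorem ker_rightHom_le_commutator (hS : S.IsStem) : S.rightHom.ker ≤ commutator E :=
  S.range_inl_eq_ker_rightHom ▸ hS.trans inf_le_right

theorem card_eq_card_ker_rightHom_mul (S : GroupExtension N E G) :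
    Nat.card E = Nat.card S.rightHom.ker * Nat.card G := by
  rw [mul_comm, ← Nat.card_congr S.quotientKerRightHomEquivRight.toEquiv,
    ← Subgroup.card_eq_card_quotient_mul_card_subgroup]

theorem rightHom_mem_universalVerts_iff (hS : S.rightHom.ker ≤ Subgroup.center E) {a : E} :
    S.rightHom a ∈ S.deepCommutingGraph.universalVerts ↔ a ∈ Subgroup.center E := by
  constructor
  · refine fun ha => Subgroup.mem_center_iff.2 fun b => ?_
    rcases eq_or_ne (S.rightHom a) (S.rightHom b) with hab | hab
    · obtain ⟨z, hz, rfl⟩ := exists_mem_center_eq_mul hS hab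
      exact (Commute.refl b).mul_right (Subgroup.mem_center_iff.1 hz b)
    · exact ((ha hab).2 a b rfl rfl).symm
  · intro ha g hne
    refine ⟨hne, fun a' b ha' _ => ?_⟩
    obtain ⟨z, hz, rfl⟩ := exists_mem_center_eq_mul hS ha'
    exact (Subgroup.mem_center_iff.1 (mul_mem ha hz) b).symm

/-- The group extension `1 → ker π → E → G → 1` defined by a surjective homomorphism `π`. -/
def kerExtension (π : E →* G) (hπ : Function.Surjective π) : GroupExtension π.ker E G where
  inl := π.ker.subtype
  rightHom := π
  inl_injective := Subtype.val_injective
  range_inl_eq_ker_rightHom := π.ker.range_subtype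
  rightHom_surjective := hπ

theorem isStem_kerExtension_iff {π : E →* G} (hπ : Function.Surjective π) :
    (kerExtension π hπ).IsStem ↔ π.ker ≤ Subgroup.center E ⊓ commutator E := by
  rw [GroupExtension.IsStem, kerExtension, Subgroup.range_subtype]

theorem comap_center_inf_commutator {E E' : Type*} [Group E] [Group E'] (e : E ≃* E') :
    (Subgroup.center E' ⊓ commutator E').comap e.toMonoidHom =
      Subgroup.center E ⊓ commutator E := by
  rw [Subgroup.comap_inf]
  congr 1
  · exact Subgroup.ext fun _ => MulEquivClass.apply_mem_center_iff e
  · rw [Subgroup.comap_equiv_eq_map_symm', commutator_def, commutator_def, Subgroup.map_commutator,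
      Subgroup.map_top_of_surjective _ e.symm.surjective]

theorem card_le_of_ker_le_center_inf_commutator (hS : S.IsSchurCover) {E' : Type*} [Group E']
    {π : E' →* G} (hπ : Function.Surjective π)
    (hker : π.ker ≤ Subgroup.center E' ⊓ commutator E') : Nat.card E' ≤ Nat.card E := by
  have : Finite E := hS.finite
  have : Finite G := Finite.of_surjective _ S.rightHom_surjective
  have : Finite E' := ((isStem_kerExtension_iff hπ).2 hker).finite
  let e : Shrink.{v} E' ≃* E' := Shrink.mulEquiv
  have hπe : Function.Surjective (π.comp e.toMonoidHom) := hπ.comp e.surjective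
  have hstem : (kerExtension _ hπe).IsStem := by
    rw [isStem_kerExtension_iff, ← MonoidHom.comap_ker, ← comap_center_inf_commutator e]
    exact Subgroup.comap_mono hker
  exact (Nat.card_congr e.toEquiv).ge.trans (hS.card_le _ _ _ hstem)

end StemExtension

section SchurCover

open ExteriorSquare
open scoped IsMulCommutative

variable {ι : Type*} [LinearOrder ι] [Finite ι] {d : ι → ℕ}

theorem mem_center_iff_wedge_eq_zero (hd : ∀ ⦃i j⦄, i < j → d j ∣ d i) [Finite (ExteriorSquare d)]
    {E : Type*} [Group E] {π : E →* Multiplicative (∀ i, ZMod (d i))}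
    (hπ : Function.Surjective π) (hc : π.ker ≤ Subgroup.center E) (hker : π.ker ≤ commutator E)
    (hcard : Nat.card (ExteriorSquare d) ≤ Nat.card π.ker) {a : E} :
    a ∈ Subgroup.center E ↔ wedge hd (π a).toAdd = 0 := by
  obtain ⟨φ, hφ⟩ := exists_apply_wedge_eq hd (commutatorPairing_self hπ hc)
  have φ_injective : Function.Injective φ :=
    injective_of_commutatorPairing_mem_range hπ hc hker hcard fun x y => ⟨_, hφ x y⟩
  simp only [← commutatorPairing_eq_zero_iff hπ hc, DFunLike.ext_iff, ← hφ,
    AddMonoidHom.zero_apply, map_eq_zero_iff φ φ_injective]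

variable {G : Type u} {N E : Type v} [Group G] [Group N] [Group E] {S : GroupExtension N E G}

theorem card_exteriorSquare_le_card_ker_rightHom (hd : ∀ ⦃i j⦄, i < j → d j ∣ d i)
    (hS : S.IsSchurCover) (e : Multiplicative (∀ i, ZMod (d i)) ≃* G) :
    Nat.card (ExteriorSquare d) ≤ Nat.card S.rightHom.ker := by
  have : Finite E := hS.finite
  have : Finite G := Finite.of_surjective _ S.rightHom_surjective
  have card_G : Nat.card (∀ i, ZMod (d i)) = Nat.card G :=
    Nat.card_congr (Multiplicative.ofAdd.trans e.toEquiv)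
  let π : BilinearExtension (cocycle hd) →* G :=
    e.toMonoidHom.comp (BilinearExtension.proj (cocycle hd))
  have π_surjective : Function.Surjective π :=
    e.surjective.comp BilinearExtension.proj_surjective
  have ker_le : π.ker ≤ Subgroup.center _ ⊓ commutator _ :=
    (MonoidHom.ker_mulEquiv_comp _ e).trans_le
      (BilinearExtension.ker_proj_le_center_inf_commutator (closure_range_wedge hd))
  have card_le := card_le_of_ker_le_center_inf_commutator hS π_surjective ker_le
  rw [BilinearExtension.card_eq, card_eq_card_ker_rightHom_mul S, card_G, mul_comm] at card_le
  exact Nat.le_of_mul_le_mul_right card_le Nat.card_pos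

theorem apply_ofAdd_mem_universalVerts_iff (hd : ∀ ⦃i j⦄, i < j → d j ∣ d i)
    (hS : S.IsSchurCover) (e : Multiplicative (∀ i, ZMod (d i)) ≃* G) {x : ∀ i, ZMod (d i)} :
    e (.ofAdd x) ∈ S.deepCommutingGraph.universalVerts ↔ wedge hd x = 0 := by
  have : Finite E := hS.finite
  have (i : ι) : Finite (ZMod (d i)) := by
    have : Finite (Multiplicative (∀ i, ZMod (d i))) :=
      Finite.of_surjective _ (e.symm.surjective.comp S.rightHom_surjective)
    exact Finite.of_surjective (fun x : Multiplicative (∀ i, ZMod (d i)) => x.toAdd i)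
      (Function.surjective_eval i)
  let π : E →* Multiplicative (∀ i, ZMod (d i)) := e.symm.toMonoidHom.comp S.rightHom
  have π_surjective : Function.Surjective π := e.symm.surjective.comp S.rightHom_surjective
  have ker_eq : π.ker = S.rightHom.ker := MonoidHom.ker_mulEquiv_comp _ e.symm
  obtain ⟨a, ha⟩ := S.rightHom_surjective (e (.ofAdd x))
  have π_a : π a = .ofAdd x := (congrArg e.symm ha).trans (e.symm_apply_apply _)
  rw [← ha, rightHom_mem_universalVerts_iff (ker_rightHom_le_center hS.isStem),
    mem_center_iff_wedge_eq_zero hd π_surjective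
      (ker_eq.trans_le (ker_rightHom_le_center hS.isStem))
      (ker_eq.trans_le (ker_rightHom_le_commutator hS.isStem))
      (ker_eq ▸ card_exteriorSquare_le_card_ker_rightHom hd hS e),
    π_a, toAdd_ofAdd]

theorem universalVerts_eq_zpowers {n : ℕ} {d : Fin (n + 2) → ℕ}
    (hd : ∀ ⦃i j⦄, i < j → d j ∣ d i) (hS : S.IsSchurCover)
    (e : Multiplicative (∀ i, ZMod (d i)) ≃* G) :
    S.deepCommutingGraph.universalVerts =
      Subgroup.zpowers (e (.ofAdd (Pi.single 0 1)) ^ d 1) := by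
  ext g
  obtain ⟨x, rfl⟩ := (e.surjective.comp Multiplicative.ofAdd.surjective) g
  rw [Function.comp_apply, apply_ofAdd_mem_universalVerts_iff hd hS,
    wedge_eq_zero_iff_mem_zmultiples, SetLike.mem_coe, ← map_pow, ← ofAdd_nsmul]
  simp only [AddSubgroup.mem_zmultiples_iff, Subgroup.mem_zpowers_iff, ← map_zpow,
    ← ofAdd_zsmul, e.injective.eq_iff, Multiplicative.ofAdd.injective.eq_iff]

end SchurCover

theorem exists_mulEquiv_pi_zmod_apply_single {ι : Type*} [DecidableEq ι] {C : ι → Type*}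
    [∀ i, CommGroup (C i)] [∀ i, IsCyclic (C i)] (i : ι) {x : C i}
    (hx : ∀ y, y ∈ Subgroup.zpowers x) :
    ∃ e : Multiplicative (∀ j, ZMod (Nat.card (C j))) ≃* ∀ j, C j,
      e (.ofAdd (Pi.single i 1)) = Pi.mulSingle i x := by
  obtain ⟨y, hyi, hy⟩ : ∃ y : ∀ j, C j, y i = x ∧ ∀ j z, z ∈ Subgroup.zpowers (y j) := by
    choose y hy using fun j => IsCyclic.exists_generator (α := C j)
    refine ⟨Function.update y i x, Function.update_self .., fun j => ?_⟩
    rcases eq_or_ne j i with rfl | hj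
    · rwa [Function.update_self]
    · rw [Function.update_of_ne hj]
      exact hy j
  refine ⟨(MulEquiv.piMultiplicative _).trans <| MulEquiv.piCongrRight fun j =>
    zmodMulEquivOfGenerator (hy j) rfl, funext fun j => ?_⟩
  rcases eq_or_ne j i with rfl | hj
  · simp [hyi]
  · simp [hj]

theorem mainTheorem7_general (n : ℕ)
    (C : Fin (n + 2) → Type u) [∀ i, CommGroup (C i)] [∀ i, IsCyclic (C i)]
    (hC : ∀ ⦃i j⦄, i < j → Nat.card (C j) ∣ Nat.card (C i))
    (G : Type u) [Group G] (e : G ≃* ∀ i, C i)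
    (x₁ : C 0) (hx₁ : ∀ y : C 0, y ∈ Subgroup.zpowers x₁)
    (N E : Type v) [Group N] [Group E] (S : GroupExtension N E G) (hS : S.IsSchurCover) :
    S.deepCommutingGraph.universalVerts =
      (Subgroup.zpowers (e.symm (Pi.mulSingle 0 x₁) ^ Nat.card (C 1)) : Set G) ∧
    (S.deepCommutingGraph.universalVerts = {1} ↔ Nat.card (C 0) = Nat.card (C 1)) := by
  obtain ⟨e', he'⟩ := exists_mulEquiv_pi_zmod_apply_single 0 hx₁
  have universalVerts_eq : S.deepCommutingGraph.universalVerts =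
      Subgroup.zpowers (e.symm (Pi.mulSingle 0 x₁) ^ Nat.card (C 1)) := by
    rw [universalVerts_eq_zpowers hC hS (e'.trans e.symm), MulEquiv.trans_apply, he']
  have order_eq : orderOf (e.symm (Pi.mulSingle 0 x₁)) = Nat.card (C 0) := by
    rw [MulEquiv.orderOf_eq, orderOf_piMulSingle, orderOf_eq_card_of_forall_mem_zpowers hx₁]
  refine ⟨universalVerts_eq, ?_⟩
  rw [universalVerts_eq, ← Subgroup.coe_bot, SetLike.coe_set_eq, Subgroup.zpowers_eq_bot,
    ← orderOf_dvd_iff_pow_eq_one, order_eq]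
  exact ⟨fun h => h.antisymm (hC Fin.zero_lt_one), Eq.dvd⟩

theorem mainTheorem7 (p n : ℕ) (hp : p.Prime) (r : Fin (n + 2) → ℕ) (hr : Antitone r)
    (C : Fin (n + 2) → Type u) [∀ i, CommGroup (C i)] [∀ i, IsCyclic (C i)]
    (hC : ∀ i, Nat.card (C i) = p ^ r i)
    (G : Type u) [CommGroup G] (hG : ¬ IsCyclic G) (e : G ≃* ∀ i, C i)
    (x₁ : C 0) (hx₁ : ∀ y : C 0, y ∈ Subgroup.zpowers x₁)
    (N E : Type v) [Group N] [Group E] (S : GroupExtension N E G) (hS : S.IsSchurCover) :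
    S.deepCommutingGraph.universalVerts =
      (Subgroup.zpowers (e.symm (Pi.mulSingle 0 x₁) ^ p ^ r 1) : Set G) ∧
    (S.deepCommutingGraph.universalVerts = {1} ↔ r 0 = r 1) := by
  have card_dvd ⦃i j⦄ (hij : i < j) : Nat.card (C j) ∣ Nat.card (C i) := by
    rw [hC, hC]
    exact pow_dvd_pow p (hr hij.le)
  have h := mainTheorem7_general n C card_dvd G e x₁ hx₁ N E S hS
  rwa [hC, hC, (Nat.pow_right_injective hp.two_le).eq_iff] at h
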